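/- For $\tau$ in the upper half-plane $\mathbb H$ put $q=e^{2\pi i\tau}$ and $$E_2=1-24\sum_{n\ge1}\sigma_1(n)q^n,\quad E_4=1+240\sum_{n\ge1}\sigma_3(n)q^n,\quad E_6=1-504\sum_{n\ge1}\sigma_5(n)q^n,$$ $$\Delta=\tfrac1{1728}(E_4^3-E_6^2),\qquad J=\frac{E_4^3}{E_4^3-E_6^2}.$$ Let $\Delta^{-5/12}$ denote the holomorphic branch on $\mathbb H$ that is positive on the positive imaginary axis, and define $$a_2=\Delta^{-5/12}(E_2E_4-E_6),\qquad a_1=\tau a_2-\tfrac{6i}{\pi}E_4\Delta^{-5/12}.$$ Then $a_1$ and $a_2$, considered (locally, as multi-valued functions) as functions of $z=J$, form a fundamental system of the hypergeometric equation $$w''(z)+\frac{7z-4}{6z(z-1)}\,w'(z)-\frac{35}{144\,z(z-1)}\,w(z)=0 .$$ Precisely: 1. Every $z_0\in\mathbb C\setminus\{0,1\}$ is a value of $J$, and for every $\tau_0\in\mathbb H$ with $J(\tau_0)\notin\{0,1\}$ there are a domain $U\ni J(\tau_0)$ and a holomorphic $g:U\to\mathbb H$ with $J(g(z))=z$ for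 all $z\in U$ and $g(J(\tau_0))=\tau_0$. 2. If $U\subseteq\mathbb C$ is a domain (open, connected, non-empty) and $g:U\to\mathbb H$ is any holomorphic map with $J(g(z))=z$ for all $z\in U$, then $U\subseteq\mathbb C\setminus\{0,1\}$, and $a_1\circ g$ and $a_2\circ g$ form a basis of the space of holomorphic solutions of the equation on $U$: both are solutions on $U$, they are linearly independent over $\mathbb C$, and every holomorphic solution on $U$ is a complex linear combination of them. -/

import Mathlib

open Complex ModularForm EisensteinSeries
open UpperHalfPlane hiding I

namespace EisensteinODE

/-- The discriminant `Δ = (E₄³ - E₆²) / 1728`. -/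
noncomputable def delta (τ : ℍ) : ℂ := (1 / 1728) * (E₄ τ ^ 3 - E₆ τ ^ 2)

/-- The modular function `J = E₄³ / (E₄³ - E₆²)`. -/
noncomputable def J (τ : ℍ) : ℂ := E₄ τ ^ 3 / (E₄ τ ^ 3 - E₆ τ ^ 2)

/-- `f` is the branch of `Δ^(m/12)` on the upper half-plane that is normalized by being positive
on the positive imaginary axis: `f` is holomorphic, `f ^ 12 = Δ ^ m`, and `f (i t) > 0` for all
`t > 0`. -/
structure IsDeltaPow (m : ℤ) (f : ℍ → ℂ) : Prop where
  holomorphic : DifferentiableOn ℂ (f ∘ ofComplex) {z : ℂ | 0 < z.im}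
  pow_eq : ∀ τ : ℍ, f τ ^ 12 = delta τ ^ m
  pos : ∀ τ : ℍ, τ.re = 0 → ∃ r : ℝ, 0 < r ∧ f τ = r

/-- The normalized branch of `Δ^(m/12)`, written with the Dedekind eta function `η = Δ^(1/24)`;
`isDeltaPow_iff` states that this is the one and only function with `IsDeltaPow m`. -/
noncomputable def deltaPow (m : ℤ) (τ : ℍ) : ℂ := ModularForm.eta τ ^ (2 * m)

theorem delta_eq (τ : ℍ) : delta τ = ModularForm.eta τ ^ 24 := by
  have h := discriminant_eq_E₄_cube_sub_E₆_sq τ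
  simp only [ModularForm.discriminant] at h
  rw [delta, h]
  ring

theorem eta_pos (τ : ℍ) (h : τ.re = 0) : ∃ r : ℝ, 0 < r ∧ ModularForm.eta τ = r := by
  have hτ : (τ : ℂ) = (τ.im : ℂ) * I := by
    apply Complex.ext <;> simp [h]
  have hexp (c : ℝ) : Function.Periodic.qParam c τ = (Real.exp (-2 * Real.pi * τ.im / c) : ℝ) := by
    rw [Function.Periodic.qParam, hτ, Complex.ofReal_exp]
    congr 1
    push_cast
    have : I * I = -1 := I_mul_I
    linear_combination (2 * Real.pi * τ.im / c : ℂ) * this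
  set x : ℝ := Real.exp (-2 * Real.pi * τ.im / 1) with hx
  have hx1 : x < 1 := by
    rw [hx, Real.exp_lt_one_iff]
    have := mul_pos Real.pi_pos τ.im_pos
    nlinarith
  have hx0 : 0 < x := Real.exp_pos _
  have hprod : ∏' n, (1 - ModularForm.eta_q n τ) = ((∏' n : ℕ, (1 - x ^ (n + 1)) : ℝ) : ℂ) := by
    have hmap := Function.LeftInverse.map_tprod (L := SummationFilter.unconditional ℕ)
      (fun n : ℕ => 1 - x ^ (n + 1)) (g := Complex.ofRealHom) continuous_ofReal
      (g' := Complex.re) continuous_re (fun r => ofReal_re r)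
    rw [ofRealHom_eq_coe] at hmap
    rw [hmap]
    refine tprod_congr fun n => ?_
    rw [ModularForm.eta_q, hexp 1, ← hx, ofRealHom_eq_coe]
    push_cast
    rfl
  have hne : ∏' n, (1 - ModularForm.eta_q n τ) ≠ 0 := ModularForm.eta_tprod_ne_zero τ.2
  refine ⟨Real.exp (-2 * Real.pi * τ.im / 24) * ∏' n : ℕ, (1 - x ^ (n + 1)),
    mul_pos (Real.exp_pos _) (lt_of_le_of_ne ?_ ?_), ?_⟩
  · by_cases hm : Multipliable fun n : ℕ => (1 - x ^ (n + 1))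
    · refine ge_of_tendsto' hm.hasProd fun s => Finset.prod_nonneg fun n _ => ?_
      have := pow_le_one₀ (n := n + 1) hx0.le hx1.le
      linarith
    · rw [tprod_eq_one_of_not_multipliable hm]
      exact zero_le_one
  · intro h0
    rw [hprod, ← h0] at hne
    simp at hne
  · rw [ModularForm.eta, hprod, hexp 24]
    push_cast
    rfl

theorem isDeltaPow_deltaPow (m : ℤ) : IsDeltaPow m (deltaPow m) where
  holomorphic := by
    have : DifferentiableOn ℂ (fun z => ModularForm.eta z ^ (2 * m)) {z : ℂ | 0 < z.im} :=
      fun z hz => ((ModularForm.differentiableAt_eta_of_mem_upperHalfPlaneSet hz).zpow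
        (Or.inl (ModularForm.eta_ne_zero hz))).differentiableWithinAt
    refine this.congr fun z hz => ?_
    simp [deltaPow, ofComplex_apply_of_im_pos hz]
  pow_eq τ := by
    rw [delta_eq, deltaPow, ← zpow_natCast, ← zpow_natCast, ← zpow_mul, ← zpow_mul]
    congr 1
    push_cast
    ring
  pos τ h := by
    obtain ⟨r, hr, h⟩ := eta_pos τ h
    exact ⟨r ^ (2 * m), zpow_pos hr _, by simp [deltaPow, h]⟩

theorem isDeltaPow_iff (m : ℤ) (f : ℍ → ℂ) : IsDeltaPow m f ↔ f = deltaPow m := by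
  refine ⟨fun hf => ?_, fun h => h ▸ isDeltaPow_deltaPow m⟩
  have hg := isDeltaPow_deltaPow m
  have hopen : IsOpen {z : ℂ | 0 < z.im} := isOpen_lt continuous_const continuous_im
  have haxis : ∀ τ : ℍ, τ.re = 0 → f τ = deltaPow m τ := by
    intro τ hτ
    obtain ⟨r, hr, h1⟩ := hf.pos τ hτ
    obtain ⟨s, hs, h2⟩ := hg.pos τ hτ
    have h3 := (hf.pow_eq τ).trans (hg.pow_eq τ).symm
    rw [h1, h2] at h3 ⊢
    norm_cast at h3 ⊢
    exact (pow_left_inj₀ hr.le hs.le (by norm_num)).1 h3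
  have hfreq : ∃ᶠ z in nhdsWithin I {I}ᶜ, (f ∘ ofComplex) z = (deltaPow m ∘ ofComplex) z := by
    have ht : Filter.Tendsto (fun t : ℝ => (t : ℂ) * I) (nhdsWithin 1 {1}ᶜ)
        (nhdsWithin I {I}ᶜ) := by
      refine tendsto_nhdsWithin_of_tendsto_nhds_of_eventually_within _ ?_ ?_
      · have : ContinuousAt (fun t : ℝ => (t : ℂ) * I) 1 := by fun_prop
        have h := this.tendsto
        simp only [ofReal_one, one_mul] at h
        exact h.mono_left nhdsWithin_le_nhds
      · filter_upwards [self_mem_nhdsWithin] with t ht h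
        apply ht
        have := congrArg Complex.im h
        simpa using this
    refine ht.frequently (Filter.Eventually.frequently ?_)
    filter_upwards [nhdsWithin_le_nhds (lt_mem_nhds (zero_lt_one (α := ℝ)))] with t ht
    have him : 0 < ((t : ℂ) * I).im := by simpa using ht
    simp only [Function.comp, ofComplex_apply_of_im_pos him]
    exact haxis _ (by rw [← UpperHalfPlane.coe_re]; simp)
  have heq := AnalyticOnNhd.eqOn_of_preconnected_of_frequently_eq
    (hf.holomorphic.analyticOnNhd hopen) (hg.holomorphic.analyticOnNhd hopen)
    (convex_halfSpace_im_gt 0).isPreconnected (by simp : I ∈ {z : ℂ | 0 < z.im}) hfreq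
  funext τ
  simpa using heq τ.2

/-- `a₂ = Δ^(-5/12) (E₂ E₄ - E₆)`. -/
noncomputable def a₂ (τ : ℍ) : ℂ := deltaPow (-5) τ * (E2 τ * E₄ τ - E₆ τ)

/-- `a₁ = τ a₂ - (6 i / π) E₄ Δ^(-5/12)`. -/
noncomputable def a₁ (τ : ℍ) : ℂ :=
  (τ : ℂ) * a₂ τ - (6 * I / Real.pi) * E₄ τ * deltaPow (-5) τ

/-- `g` is a holomorphic branch on `U` of the (multi-valued) inverse of `J`. -/
structure IsInverseBranch (U : Set ℂ) (g : ℂ → ℍ) : Prop where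
  holomorphic : DifferentiableOn ℂ (fun z => (g z : ℂ)) U
  J_apply : ∀ z ∈ U, J (g z) = z

/-- `w` is a holomorphic solution of `w'' + p w' + q w = 0` on the open set `U`. -/
structure IsSolution (p q : ℂ → ℂ) (U : Set ℂ) (w : ℂ → ℂ) : Prop where
  holomorphic : DifferentiableOn ℂ w U
  ode : ∀ z ∈ U, deriv (deriv w) z + p z * deriv w z + q z * w z = 0

/-- `w₁, w₂` form a fundamental system of `w'' + p w' + q w = 0` on the domain `U`: a basis of the
space of holomorphic solutions on `U`. -/
structure IsFundamentalSystem (p q : ℂ → ℂ) (U : Set ℂ) (w₁ w₂ : ℂ → ℂ) : Prop where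
  solution₁ : IsSolution p q U w₁
  solution₂ : IsSolution p q U w₂
  independent : ∀ c₁ c₂ : ℂ, (∀ z ∈ U, c₁ * w₁ z + c₂ * w₂ z = 0) → c₁ = 0 ∧ c₂ = 0
  spanning : ∀ w : ℂ → ℂ, IsSolution p q U w →
    ∃ c₁ c₂ : ℂ, ∀ z ∈ U, w z = c₁ * w₁ z + c₂ * w₂ z

end EisensteinODE

/-! Write `D` for (2πi)⁻¹ d/dτ. Ramanujan's identities express `D` of E₂, E₄, E₆ as polynomials in
E₂, E₄, E₆, and D Δ^(m/12) = (m/12) E₂ Δ^(m/12). A direct computation then shows that a₁ and a₂ both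
satisfy D²F - E₂ DF / 6 - 35 E₄ F / 144 = 0. Substituting z = J turns this into the hypergeometric
equation (`isSolution_comp_inverseBranch`). The Wronskian of a₁ and a₂ is a non-zero multiple of
Δ^(1/6), so it never vanishes; on a connected set this gives both independence and spanning.

Ramanujan's identities hold because the Serre derivatives of E₄ and E₆, and D E₂ - E₂²/12, are
modular forms of weights 6, 8 and 4. These spaces are one-dimensional, so the limit at i∞ fixes the
constant (`eq_smul_of_rank_one`).

Since DJ = -E₄²E₆/(E₄³ - E₆²) vanishes only where J is 0 or 1, the inverse function theorem gives
local branches elsewhere, and no branch can reach 0 or 1. Surjectivity of J follows from the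
constancy of modular forms of weight zero. -/

namespace EisensteinODE

/-! ### Limits at i∞ and Ramanujan's differential identities -/

section Ramanujan

open Filter Topology Derivative
open scoped Manifold MatrixGroups Real

/-- Cauchy estimate: the derivative of a holomorphic function bounded at `i∞` tends to zero. -/
theorem tendsto_normalizedDeriv_atImInfty {F : ℍ → ℂ} (hF : MDiff F) (hb : IsBoundedAtImInfty F) :
    Tendsto (D F) atImInfty (𝓝 0) := by
  obtain ⟨M, A, hM⟩ := isBoundedAtImInfty_iff.1 hb
  have hd := UpperHalfPlane.mdifferentiable_iff.1 hF
  have hderiv : Tendsto (fun τ : ℍ => deriv (F ∘ ofComplex) τ) atImInfty (𝓝 0) := by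
    have him : Tendsto (fun τ : ℍ => τ.im - max A 0) atImInfty atTop :=
      tendsto_atTop_add_const_right _ _ tendsto_comap
    have hlim : Tendsto (fun τ : ℍ => M / ((τ.im - max A 0) / 2)) atImInfty (𝓝 0) :=
      (him.atTop_div_const two_pos).const_div_atTop M
    refine squeeze_zero_norm' ?_ hlim
    filter_upwards [him.eventually_gt_atTop 0] with τ hτ
    -- Half the distance to the line Im = max(A, 0): the closed disc stays where F is holomorphic
    -- and bounded by M, and the radius grows with Im τ.
    set r : ℝ := (τ.im - max A 0) / 2 with hr
    have hr0 : 0 < r := by positivity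
    have hmem : ∀ z ∈ Metric.closedBall (τ : ℂ) r, max A 0 < z.im := by
      intro z hz
      have h1 : |(z - τ).im| ≤ r :=
        (abs_im_le_norm _).trans (by simpa [dist_eq_norm] using hz)
      have h2 := (abs_le.1 h1).1
      rw [sub_im, UpperHalfPlane.coe_im] at h2
      linarith
    refine norm_deriv_le_of_forall_mem_sphere_norm_le hr0 ?_ fun z hz => ?_
    · refine DifferentiableOn.diffContOnCl ?_
      rw [closure_ball _ hr0.ne']
      exact hd.mono fun z hz => (le_max_right A 0).trans_lt (hmem z hz)
    · have hz' := hmem z (Metric.sphere_subset_closedBall hz)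
      have hz0 : 0 < z.im := (le_max_right A 0).trans_lt hz'
      rw [Function.comp_apply, ofComplex_apply_of_im_pos hz0]
      exact hM _ ((le_max_left A 0).trans hz'.le)
  have h := hderiv.const_mul ((2 * π * Complex.I)⁻¹)
  rwa [mul_zero] at h

/-- A holomorphic function on `ℍ` that is slash invariant under `SL(2, ℤ)` and bounded at `i∞`
is a modular form of level one. -/
def modularFormOfInvariant {k : ℤ} (f : ℍ → ℂ) (hf : MDiff f)
    (hslash : ∀ γ : SL(2, ℤ), f ∣[k] γ = f) (hb : IsBoundedAtImInfty f) : ModularForm 𝒮ℒ k where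
  toFun := f
  slash_action_eq' := fun _ ⟨γ, hγ⟩ => hγ ▸ hslash γ
  holo' := hf
  -- Every cusp is an SL(2, ℤ)-translate of ∞, so slash invariance reduces boundedness there to
  -- boundedness at i∞.
  bdd_at_cusps' {c} hc := by
    rw [Subgroup.IsArithmetic.isCusp_iff_isCusp_SL2Z] at hc
    rw [OnePoint.isBoundedAt_iff_forall_SL2Z hc]
    intro γ _
    rwa [hslash γ]

theorem slash_eq_self {k : ℤ} (f : ModularForm 𝒮ℒ k) (γ : SL(2, ℤ)) : (f : ℍ → ℂ) ∣[k] γ = f :=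
  SlashInvariantFormClass.slash_action_eq f _ ⟨γ, rfl⟩

/-- As a function of q, the form extends continuously to q = 0, and q tends to 0 at i∞. -/
theorem tendsto_coeff_zero {k : ℤ} (f : ModularForm 𝒮ℒ k) :
    Tendsto f atImInfty (𝓝 ((qExpansion 1 f).coeff 0)) := by
  have han := ModularFormClass.analyticAt_cuspFunction_zero f one_pos one_mem_strictPeriods_SL
  have hper := SlashInvariantFormClass.periodic_comp_ofComplex f one_mem_strictPeriods_SL
  rw [qExpansion_coeff_zero one_pos han hper, ← cuspFunction_apply_zero one_pos han hper]
  have : (cuspFunction 1 f ∘ fun τ : ℍ => Function.Periodic.qParam 1 τ) = f := by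
    funext τ
    simpa using UpperHalfPlane.eq_cuspFunction τ one_ne_zero hper
  simpa [this] using han.continuousAt.tendsto.comp (qParam_tendsto_atImInfty one_pos)

theorem tendsto_E₄ : Tendsto E₄ atImInfty (𝓝 1) := by
  have h := tendsto_coeff_zero E₄
  rwa [E_qExpansion_coeff_zero _ ⟨2, rfl⟩] at h

theorem tendsto_E₆ : Tendsto E₆ atImInfty (𝓝 1) := by
  have h := tendsto_coeff_zero E₆
  rwa [E_qExpansion_coeff_zero _ ⟨3, rfl⟩] at h

theorem isBoundedAtImInfty_of_tendsto {f : ℍ → ℂ} {c : ℂ} (h : Tendsto f atImInfty (𝓝 c)) :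
    IsBoundedAtImInfty f :=
  h.isBigO_one ℝ

theorem hasDerivAt_ofComplex {F : ℍ → ℂ} (hF : MDiff F) (τ : ℍ) :
    HasDerivAt (F ∘ ofComplex) (2 * π * Complex.I * D F τ) τ := by
  have h := (UpperHalfPlane.mdifferentiableAt_iff.1 (hF τ)).hasDerivAt
  convert! h using 1
  rw [normalizedDerivOfComplex, mul_inv_cancel_left₀ two_pi_I_ne_zero]

theorem hasDerivAt_eta (τ : ℍ) :
    HasDerivAt ModularForm.eta (π * Complex.I / 12 * E2 τ * ModularForm.eta τ) τ := by
  have h := (differentiableAt_eta_of_mem_upperHalfPlaneSet τ.2).hasDerivAt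
  convert! h using 1
  rw [← logDeriv_eta_eq_E2, logDeriv_apply, div_mul_cancel₀ _ (eta_ne_zero τ.2)]

/-- The product part `∏ (1 - qⁿ)²⁴` of the discriminant has `D f = (E₂ - 1) f`. -/
theorem normalizedDeriv_discriminant_div_q :
    ∃ f : ℍ → ℂ, MDiff f ∧ Tendsto f atImInfty (𝓝 1) ∧ ∀ τ, D f τ = (E2 τ - 1) * f τ := by
  -- This is Δ/q; removing the factor q lowers the logarithmic derivative E₂ by 1.
  set p : ℂ → ℂ := fun z => ModularForm.eta z ^ 24 * cexp (-(2 * π * Complex.I * z)) with hp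
  have hder (τ : ℍ) : HasDerivAt p (2 * π * Complex.I * ((E2 τ - 1) * p τ)) τ := by
    have h1 := (hasDerivAt_eta τ).pow 24
    have h2 : HasDerivAt (fun z : ℂ => cexp (-(2 * π * Complex.I * z)))
        (cexp (-(2 * π * Complex.I * τ)) * -(2 * π * Complex.I * 1)) τ :=
      (((hasDerivAt_id (τ : ℂ)).const_mul _).neg).cexp
    refine (h1.mul h2).congr_deriv ?_
    simp only [hp, Pi.pow_apply]
    push_cast
    ring
  have hev (τ : ℍ) : (fun τ : ℍ => p τ) ∘ ofComplex =ᶠ[𝓝 (τ : ℂ)] p := by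
    filter_upwards [isOpen_upperHalfPlaneSet.mem_nhds τ.2] with z hz
    simp [ofComplex_apply_of_im_pos hz]
  refine ⟨fun τ => p τ, fun τ => UpperHalfPlane.mdifferentiableAt_iff.2
    ((hder τ).congr_of_eventuallyEq (hev τ)).differentiableAt, ?_, fun τ => ?_⟩
  · refine tendsto_atImInfty_tprod_one_sub_eta_q_pow.congr fun τ => ?_
    have h := discriminant_eq_q_prod τ
    rw [ModularForm.discriminant] at h
    simp only [hp]
    rw [h, Function.Periodic.qParam, mul_right_comm, ← Complex.exp_add]
    simp
  · rw [normalizedDerivOfComplex, ((hder τ).congr_of_eventuallyEq (hev τ)).deriv,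
      inv_mul_cancel_left₀ two_pi_I_ne_zero]

/-- E₂ - 1 = Df/f for f = Δ/q. Here f tends to 1, so it is bounded and the Cauchy estimate sends Df
to 0. -/
theorem tendsto_E2 : Tendsto E2 atImInfty (𝓝 1) := by
  obtain ⟨f, hf, hlim, hD⟩ := normalizedDeriv_discriminant_div_q
  have h := ((tendsto_normalizedDeriv_atImInfty hf (isBoundedAtImInfty_of_tendsto hlim)).div hlim
    one_ne_zero).add_const 1
  rw [zero_div, zero_add] at h
  refine h.congr' ?_
  filter_upwards [hlim.eventually_ne one_ne_zero] with τ hτ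
  simp only [Pi.div_apply, hD]
  field_simp
  ring

theorem tendsto_serreDerivative {k : ℤ} {f : ℍ → ℂ} {c : ℂ} (hf : MDiff f)
    (h : Tendsto f atImInfty (𝓝 c)) :
    Tendsto (serreDerivative k f) atImInfty (𝓝 (-(k / 12) * c)) := by
  have := (tendsto_normalizedDeriv_atImInfty hf (isBoundedAtImInfty_of_tendsto h)).sub
    ((tendsto_E2.const_mul (k * 12⁻¹ : ℂ)).mul h)
  rw [serreDerivative_eq]
  convert! this using 2
  ring

/-- If the space of modular forms of weight `k` is one-dimensional, a form is determined by its
limit at `i∞`. -/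
theorem eq_smul_of_rank_one {k : ℤ} (hrank : Module.rank ℂ (ModularForm 𝒮ℒ k) = 1)
    (E : ModularForm 𝒮ℒ k) (hE : Tendsto E atImInfty (𝓝 1)) {f : ℍ → ℂ} {c : ℂ} (hf : MDiff f)
    (hslash : ∀ γ : SL(2, ℤ), f ∣[k] γ = f) (hlim : Tendsto f atImInfty (𝓝 c)) (τ : ℍ) :
    f τ = c * E τ := by
  have hE0 : E ≠ 0 := by
    rintro rfl
    exact zero_ne_one (tendsto_nhds_unique (tendsto_const_nhds (x := (0 : ℂ))) hE)
  obtain ⟨a, ha⟩ := (finrank_eq_one_iff_of_nonzero' E hE0).1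
    (Module.rank_eq_one_iff_finrank_eq_one.1 hrank)
    (modularFormOfInvariant f hf hslash (isBoundedAtImInfty_of_tendsto hlim))
  have hfE (τ : ℍ) : a * E τ = f τ := congrArg (fun g : ModularForm 𝒮ℒ k => g τ) ha
  have hac : a = c := by
    refine tendsto_nhds_unique ?_ hlim
    have h := hE.const_mul a
    rw [mul_one] at h
    exact h.congr hfE
  rw [← hfE, hac]

theorem rank_weight_eight : Module.rank ℂ (ModularForm 𝒮ℒ 8) = 1 := by
  simpa [Nat.ModEq] using dimension_level_one 8 ⟨4, rfl⟩

/-- Ramanujan's identity for `E₄`. -/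
theorem normalizedDeriv_E₄ (τ : ℍ) : D E₄ τ = (E2 τ * E₄ τ - E₆ τ) / 3 := by
  have h := eq_smul_of_rank_one (k := 6) levelOne_weight_six_rank_one E₆ tendsto_E₆
    (serreDerivative_mdifferentiable ((4 : ℤ) : ℂ) E₄.holo')
    (fun γ => serreDerivative_slash_invariant (k := 4) E₄.holo' (slash_eq_self E₄ γ))
    (tendsto_serreDerivative (k := 4) E₄.holo' tendsto_E₄) τ
  change D E₄ τ - ((4 : ℤ) : ℂ) * 12⁻¹ * E2 τ * E₄ τ = _ at h
  push_cast at h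
  linear_combination h

/-- Ramanujan's identity for `E₆`. -/
theorem normalizedDeriv_E₆ (τ : ℍ) : D E₆ τ = (E2 τ * E₆ τ - E₄ τ ^ 2) / 2 := by
  have hlim : Tendsto (E₄.mul E₄) atImInfty (𝓝 1) := by
    have h := tendsto_E₄.mul tendsto_E₄
    rwa [mul_one] at h
  have h := eq_smul_of_rank_one (k := 8) rank_weight_eight (E₄.mul E₄) hlim
    (serreDerivative_mdifferentiable ((6 : ℤ) : ℂ) E₆.holo')
    (fun γ => serreDerivative_slash_invariant (k := 6) E₆.holo' (slash_eq_self E₆ γ))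
    (tendsto_serreDerivative (k := 6) E₆.holo' tendsto_E₆) τ
  change D E₆ τ - ((6 : ℤ) : ℂ) * 12⁻¹ * E2 τ * E₆ τ = _ * (E₄ τ * E₄ τ) at h
  push_cast at h
  linear_combination h

theorem E2_slash (γ : SL(2, ℤ)) :
    E2 ∣[(2 : ℤ)] γ = E2 + (12 : ℂ) •
      (fun τ : ℍ => (2 * π * Complex.I)⁻¹ * ((γ 1 0 : ℂ) * (denom γ τ) ^ (-1 : ℤ))) := by
  rw [E2_slash_action]
  ext τ
  have hpi : (π : ℂ) ≠ 0 := ofReal_ne_zero.2 Real.pi_ne_zero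
  have hd := denom_ne_zero (γ : GL (Fin 2) ℝ) τ
  simp only [Pi.sub_apply, Pi.add_apply, Pi.smul_apply, smul_eq_mul, D2, riemannZeta_two,
    zpow_neg_one]
  field_simp
  linear_combination (-12 * (γ 1 0 : ℂ)) * Complex.I_sq

/-- Slashing by γ turns E₂ into E₂ + 12U with DU = -U². Both D E₂ and E₂²/12 then acquire the same
extra term 2U E₂ + 12U², which cancels in the difference. -/
theorem normalizedDeriv_E2_slash (γ : SL(2, ℤ)) :
    (fun τ => D E2 τ - E2 τ ^ 2 / 12) ∣[(4 : ℤ)] γ = fun τ => D E2 τ - E2 τ ^ 2 / 12 := by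
  set U : ℍ → ℂ := fun τ => (2 * π * Complex.I)⁻¹ * ((γ 1 0 : ℂ) * (denom γ τ) ^ (-1 : ℤ)) with hU
  have hder (τ : ℍ) : HasDerivAt (U ∘ ofComplex) (-(2 * π * Complex.I) * U τ ^ 2) τ := by
    have h := ((hasDerivAt_denom_zpow (γ : GL (Fin 2) ℝ) (-1) τ).const_mul
      (γ 1 0 : ℂ)).const_mul ((2 * π * Complex.I)⁻¹)
    refine (h.congr_of_eventuallyEq ?_).congr_deriv ?_
    · filter_upwards [isOpen_upperHalfPlaneSet.mem_nhds τ.2] with z hz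
      simp [hU, ofComplex_apply_of_im_pos hz]
    · have h10 : (((γ : GL (Fin 2) ℝ) 1 0 : ℝ) : ℂ) = (γ 1 0 : ℂ) := by simp
      have hd := denom_ne_zero (γ : GL (Fin 2) ℝ) τ
      rw [h10]
      simp only [hU, show (-1 - 1 : ℤ) = -2 from rfl, zpow_neg, zpow_ofNat]
      have := two_pi_I_ne_zero
      push_cast
      field_simp
  have hUd : MDiff U := fun τ => UpperHalfPlane.mdifferentiableAt_iff.2 (hder τ).differentiableAt
  have hDU (τ : ℍ) : D U τ = -U τ ^ 2 := by
    rw [normalizedDerivOfComplex, (hder τ).deriv]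
    have := two_pi_I_ne_zero
    field_simp
  ext τ
  have h1 := congrFun (normalizedDerivOfComplex_SL_slash (k := 2) E2_mdifferentiable (γ := γ)) τ
  rw [E2_slash γ, normalizedDerivOfComplex_add _ _ E2_mdifferentiable
    (hUd.const_smul (12 : ℂ)), normalizedDerivOfComplex_smul _ _ hUd] at h1
  have h2 := congrFun (E2_slash γ) τ
  simp only [SL_slash_apply, Pi.add_apply, Pi.sub_apply, Pi.smul_apply, smul_eq_mul, hDU] at h1 h2 ⊢
  change _ = E2 τ + 12 * U τ at h2
  have hUτ : U τ = (2 * π * Complex.I)⁻¹ * ((γ 1 0 : ℂ) / denom γ τ) := by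
    simp [hU, div_eq_mul_inv]
  have hz : (denom γ τ) ^ (-(4 : ℤ)) = ((denom γ τ) ^ (-(2 : ℤ))) ^ 2 := by
    rw [← zpow_natCast, ← zpow_mul]; rfl
  rw [show (2 + 2 : ℤ) = 4 from rfl] at h1
  push_cast at h1
  rw [mul_assoc (2 : ℂ), ← hUτ] at h1
  change _ = _ - 2 * U τ * (E2 τ + 12 * U τ) at h1
  linear_combination -h1 - (E2 (γ • τ) * (denom γ τ) ^ (-(2 : ℤ)) + E2 τ + 12 * U τ) / 12 * h2
    - E2 (γ • τ) ^ 2 / 12 * hz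

/-- Ramanujan's identity for `E₂`. -/
theorem normalizedDeriv_E2 (τ : ℍ) : D E2 τ = (E2 τ ^ 2 - E₄ τ) / 12 := by
  have hlim : Tendsto (fun τ => D E2 τ - E2 τ ^ 2 / 12) atImInfty (𝓝 (-(1 / 12))) := by
    simpa using (tendsto_normalizedDeriv_atImInfty E2_mdifferentiable
      (isBoundedAtImInfty_of_tendsto tendsto_E2)).sub ((tendsto_E2.pow 2).div_const 12)
  have hmd : MDiff (show ℍ → ℂ from fun τ => D E2 τ - E2 τ ^ 2 / 12) := by
    have := (normalizedDerivOfComplex_mdifferentiable E2_mdifferentiable).sub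
      ((E2_mdifferentiable.pow 2).const_smul (12⁻¹ : ℂ))
    convert! this using 1
    ext τ
    simp [div_eq_inv_mul]
  have h := eq_smul_of_rank_one (k := 4) levelOne_weight_four_rank_one E₄ tendsto_E₄ hmd
    normalizedDeriv_E2_slash hlim τ
  linear_combination h

end Ramanujan

/-! ### The differential equation in τ and its transfer to z = J -/

section Equation

open Filter Topology Derivative
open scoped Manifold MatrixGroups Real

/-- `F` has derivative `F'` with respect to `(2πi)⁻¹ d/dτ` at every point of `ℍ`. -/
def HasNormalizedDeriv (F F' : ℍ → ℂ) : Prop :=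
  ∀ τ : ℍ, HasDerivAt (F ∘ ofComplex) (2 * π * Complex.I * F' τ) τ

theorem HasNormalizedDeriv.mul {F F' G G' : ℍ → ℂ} (hF : HasNormalizedDeriv F F')
    (hG : HasNormalizedDeriv G G') :
    HasNormalizedDeriv (fun τ => F τ * G τ) (fun τ => F' τ * G τ + F τ * G' τ) := fun τ => by
  refine ((hF τ).mul (hG τ)).congr_deriv ?_
  simp only [Function.comp_apply, ofComplex_apply]
  ring

theorem HasNormalizedDeriv.add {F F' G G' : ℍ → ℂ} (hF : HasNormalizedDeriv F F')
    (hG : HasNormalizedDeriv G G') :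
    HasNormalizedDeriv (fun τ => F τ + G τ) (fun τ => F' τ + G' τ) := fun τ =>
  ((hF τ).add (hG τ)).congr_deriv (by ring)

theorem HasNormalizedDeriv.const_mul {F F' : ℍ → ℂ} (hF : HasNormalizedDeriv F F') (c : ℂ) :
    HasNormalizedDeriv (fun τ => c * F τ) (fun τ => c * F' τ) := fun τ =>
  ((hF τ).const_mul c).congr_deriv (by ring)

theorem HasNormalizedDeriv.sub {F F' G G' : ℍ → ℂ} (hF : HasNormalizedDeriv F F')
    (hG : HasNormalizedDeriv G G') :
    HasNormalizedDeriv (fun τ => F τ - G τ) (fun τ => F' τ - G' τ) := fun τ =>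
  ((hF τ).sub (hG τ)).congr_deriv (by ring)

theorem HasNormalizedDeriv.div {F F' G G' : ℍ → ℂ} (hF : HasNormalizedDeriv F F')
    (hG : HasNormalizedDeriv G G') {τ : ℍ} (hτ : G τ ≠ 0) :
    HasDerivAt ((fun τ => F τ / G τ) ∘ ofComplex)
      (2 * π * Complex.I * ((F' τ * G τ - F τ * G' τ) / G τ ^ 2)) τ := by
  refine ((hF τ).div (hG τ) (by simpa using hτ)).congr_deriv ?_
  simp only [Function.comp_apply, ofComplex_apply]
  ring

theorem HasNormalizedDeriv.congr {F F' G' : ℍ → ℂ} (hF : HasNormalizedDeriv F F')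
    (h : ∀ τ, F' τ = G' τ) : HasNormalizedDeriv F G' :=
  funext h ▸ hF

theorem hasNormalizedDeriv_coe :
    HasNormalizedDeriv (fun τ => (τ : ℂ)) (fun _ => (2 * π * Complex.I)⁻¹) := fun τ => by
  rw [mul_inv_cancel₀ two_pi_I_ne_zero]
  refine (hasDerivAt_id (τ : ℂ)).congr_of_eventuallyEq ?_
  filter_upwards [isOpen_upperHalfPlaneSet.mem_nhds τ.2] with z hz
  simp [ofComplex_apply_of_im_pos hz]

theorem hasNormalizedDeriv_E2 : HasNormalizedDeriv E2 fun τ => (E2 τ ^ 2 - E₄ τ) / 12 :=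
  HasNormalizedDeriv.congr (hasDerivAt_ofComplex E2_mdifferentiable) normalizedDeriv_E2

theorem hasNormalizedDeriv_E₄ : HasNormalizedDeriv E₄ fun τ => (E2 τ * E₄ τ - E₆ τ) / 3 :=
  HasNormalizedDeriv.congr (hasDerivAt_ofComplex E₄.holo') normalizedDeriv_E₄

theorem hasNormalizedDeriv_E₆ : HasNormalizedDeriv E₆ fun τ => (E2 τ * E₆ τ - E₄ τ ^ 2) / 2 :=
  HasNormalizedDeriv.congr (hasDerivAt_ofComplex E₆.holo') normalizedDeriv_E₆

theorem hasNormalizedDeriv_deltaPow (m : ℤ) :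
    HasNormalizedDeriv (deltaPow m) fun τ => m / 12 * E2 τ * deltaPow m τ := fun τ => by
  have hη : ModularForm.eta τ ≠ 0 := eta_ne_zero τ.2
  have h := (hasDerivAt_zpow (2 * m) _ (Or.inl hη)).comp (τ : ℂ) (hasDerivAt_eta τ)
  refine (h.congr_of_eventuallyEq ?_).congr_deriv ?_
  · filter_upwards [isOpen_upperHalfPlaneSet.mem_nhds τ.2] with z hz
    simp [deltaPow, ofComplex_apply_of_im_pos hz]
  · simp only [deltaPow]
    rw [zpow_sub_one₀ hη]
    push_cast
    field_simp

theorem E₄_cube_sub_E₆_sq_ne_zero (τ : ℍ) : E₄ τ ^ 3 - E₆ τ ^ 2 ≠ 0 := fun h => by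
  have := discriminant_eq_E₄_cube_sub_E₆_sq τ
  rw [h, zero_div] at this
  exact discriminant_ne_zero τ this

theorem J_sub_one (τ : ℍ) : J τ - 1 = E₆ τ ^ 2 / (E₄ τ ^ 3 - E₆ τ ^ 2) := by
  have := E₄_cube_sub_E₆_sq_ne_zero τ
  rw [J]
  field_simp
  ring

/-- The denominator is 1728 Δ, whose logarithmic derivative is E₂. -/
theorem hasNormalizedDeriv_denominator :
    HasNormalizedDeriv (fun τ => E₄ τ ^ 3 - E₆ τ ^ 2)
      (fun τ => E2 τ * (E₄ τ ^ 3 - E₆ τ ^ 2)) := by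
  have h4 := hasNormalizedDeriv_E₄
  have h6 := hasNormalizedDeriv_E₆
  have h := ((h4.mul h4).mul h4).sub (h6.mul h6)
  simp only [pow_succ, pow_zero, one_mul]
  exact h.congr fun τ => by ring

/-- Numerator and denominator both have weight 12, so the E₂ terms cancel in the quotient rule. -/
theorem hasNormalizedDeriv_J :
    HasNormalizedDeriv J fun τ => -(E₄ τ ^ 2 * E₆ τ / (E₄ τ ^ 3 - E₆ τ ^ 2)) := fun τ => by
  have h4 := hasNormalizedDeriv_E₄
  have hc : HasNormalizedDeriv (fun τ => E₄ τ ^ 3) fun τ => E₄ τ ^ 2 * (E2 τ * E₄ τ - E₆ τ) := by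
    simp only [pow_succ, pow_zero, one_mul]
    exact ((h4.mul h4).mul h4).congr fun τ => by ring
  have hN := E₄_cube_sub_E₆_sq_ne_zero τ
  refine (hc.div hasNormalizedDeriv_denominator hN).congr_deriv ?_
  congr 1
  field_simp
  ring

theorem E₄_ne_zero_of_J {τ : ℍ} (h : J τ ≠ 0) : E₄ τ ≠ 0 := fun h0 => h (by simp [J, h0])

theorem E₆_ne_zero_of_J {τ : ℍ} (h : J τ ≠ 1) : E₆ τ ≠ 0 := fun h0 => by
  have := J_sub_one τ
  rw [h0] at this
  exact h (by linear_combination this)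

/-- The chain rule along a map into `ℍ`. -/
theorem HasNormalizedDeriv.comp_branch {F F' : ℍ → ℂ} (hF : HasNormalizedDeriv F F') {g : ℂ → ℍ}
    {z g' : ℂ} (hg : HasDerivAt (fun z => (g z : ℂ)) g' z) :
    HasDerivAt (fun z => F (g z)) (2 * π * Complex.I * F' (g z) * g') z := by
  have h := (hF (g z)).comp z hg
  simpa [Function.comp_def] using h

/-- The derivative of an inverse branch of `J`, up to the factor `2πi`. -/
noncomputable def branchDeriv (τ : ℍ) : ℂ := -((E₄ τ ^ 3 - E₆ τ ^ 2) / (E₄ τ ^ 2 * E₆ τ))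

/-- Differentiating J(g(z)) = z gives J'(g(z)) g'(z) = 1. Hence the factor E₄²E₆ of J' cannot vanish
at g(z), and g' is the reciprocal of J'. -/
theorem IsInverseBranch.hasDerivAt_aux {U : Set ℂ} {g : ℂ → ℍ} (hU : IsOpen U)
    (hg : IsInverseBranch U g) {z : ℂ} (hz : z ∈ U) :
    E₄ (g z) ≠ 0 ∧ E₆ (g z) ≠ 0 ∧
      HasDerivAt (fun z => (g z : ℂ)) ((2 * π * Complex.I)⁻¹ * branchDeriv (g z)) z := by
  have hgz := (hg.holomorphic.differentiableAt (hU.mem_nhds hz)).hasDerivAt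
  have h1 := hasNormalizedDeriv_J.comp_branch hgz
  have h2 : HasDerivAt (fun z => J (g z)) 1 z := by
    refine (hasDerivAt_id z).congr_of_eventuallyEq ?_
    filter_upwards [hU.mem_nhds hz] with y hy using hg.J_apply y hy
  have h3 := h1.unique h2
  have h4 : E₄ (g z) ≠ 0 := fun h0 => by simp [h0] at h3
  have h6 : E₆ (g z) ≠ 0 := fun h0 => by simp [h0] at h3
  refine ⟨h4, h6, ?_⟩
  convert! hgz using 1
  have hN := E₄_cube_sub_E₆_sq_ne_zero (g z)
  have := two_pi_I_ne_zero
  rw [branchDeriv]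
  field_simp at h3 ⊢
  linear_combination h3

theorem IsInverseBranch.ne_zero_ne_one {U : Set ℂ} {g : ℂ → ℍ} (hU : IsOpen U)
    (hg : IsInverseBranch U g) {z : ℂ} (hz : z ∈ U) : z ≠ 0 ∧ z ≠ 1 := by
  obtain ⟨h4, h6, -⟩ := hg.hasDerivAt_aux hU hz
  have hN := E₄_cube_sub_E₆_sq_ne_zero (g z)
  constructor
  · rw [← hg.J_apply z hz, J]
    exact div_ne_zero (pow_ne_zero _ h4) hN
  · rw [← sub_ne_zero, ← hg.J_apply z hz, J_sub_one]
    exact div_ne_zero (pow_ne_zero _ h6) hN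

theorem HasNormalizedDeriv.comp_inverseBranch {F F' : ℍ → ℂ} (hF : HasNormalizedDeriv F F')
    {U : Set ℂ} {g : ℂ → ℍ} (hU : IsOpen U) (hg : IsInverseBranch U g) {z : ℂ} (hz : z ∈ U) :
    HasDerivAt (fun z => F (g z)) (F' (g z) * branchDeriv (g z)) z := by
  refine (hF.comp_branch (hg.hasDerivAt_aux hU hz).2.2).congr_deriv ?_
  have := two_pi_I_ne_zero
  field_simp

theorem hasDerivAt_branchDeriv {τ : ℍ} (h4 : E₄ τ ≠ 0) (h6 : E₆ τ ≠ 0) :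
    HasDerivAt (branchDeriv ∘ ofComplex) (2 * π * Complex.I * (branchDeriv τ *
      (-(E2 τ / 6) + 2 * E₆ τ / (3 * E₄ τ) + E₄ τ ^ 2 / (2 * E₆ τ)))) τ := by
  have hd : HasNormalizedDeriv (fun τ => E₄ τ ^ 2 * E₆ τ) fun τ =>
      2 / 3 * E₄ τ * E₆ τ * (E2 τ * E₄ τ - E₆ τ) +
        E₄ τ ^ 2 * ((E2 τ * E₆ τ - E₄ τ ^ 2) / 2) := by
    simp only [pow_succ, pow_zero, one_mul]
    exact ((hasNormalizedDeriv_E₄.mul hasNormalizedDeriv_E₄).mul hasNormalizedDeriv_E₆).congr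
      fun τ => by ring
  have h := (hasNormalizedDeriv_denominator.div hd (τ := τ)
    (mul_ne_zero (pow_ne_zero 2 h4) h6)).neg
  refine h.congr_deriv ?_
  rw [branchDeriv]
  field_simp
  ring

/-- A solution on `ℍ` of the Kaneko–Zagier type equation `D²F - E₂ DF / 6 - 35 E₄ F / 144 = 0` gives
a solution of the hypergeometric equation along every inverse branch of `J`. -/
theorem isSolution_comp_inverseBranch {F F₁ F₂ : ℍ → ℂ} (h₁ : HasNormalizedDeriv F F₁)
    (h₂ : HasNormalizedDeriv F₁ F₂)
    (hode : ∀ τ, F₂ τ - E2 τ / 6 * F₁ τ - 35 / 144 * E₄ τ * F τ = 0) {U : Set ℂ} {g : ℂ → ℍ}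
    (hU : IsOpen U) (hg : IsInverseBranch U g) :
    IsSolution (fun z => (7 * z - 4) / (6 * z * (z - 1))) (fun z => -(35 / (144 * z * (z - 1)))) U
      (fun z => F (g z)) where
  holomorphic z hz :=
    (h₁.comp_inverseBranch hU hg hz).differentiableAt.differentiableWithinAt
  ode z hz := by
    obtain ⟨h4, h6, hgd⟩ := hg.hasDerivAt_aux hU hz
    have hd1 := (h₁.comp_inverseBranch hU hg hz).deriv
    have hev : deriv (fun z => F (g z)) =ᶠ[𝓝 z] fun z => F₁ (g z) * branchDeriv (g z) := by
      filter_upwards [hU.mem_nhds hz] with y hy using (h₁.comp_inverseBranch hU hg hy).deriv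
    have hK := (hasDerivAt_branchDeriv h4 h6).comp z hgd
    simp only [Function.comp_def, ofComplex_apply] at hK
    have hd2 := (((h₂.comp_inverseBranch hU hg hz).mul hK).congr_of_eventuallyEq hev).deriv
    have hN := E₄_cube_sub_E₆_sq_ne_zero (g z)
    have hJ := hg.J_apply z hz
    have hJ1 : z - 1 = E₆ (g z) ^ 2 / (E₄ (g z) ^ 3 - E₆ (g z) ^ 2) := by rw [← J_sub_one, hJ]
    have hz' : z = E₄ (g z) ^ 3 / (E₄ (g z) ^ 3 - E₆ (g z) ^ 2) := by rw [← J, hJ]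
    -- With K = `branchDeriv`, the derivative of K along g is K²(-E₂/6 + S). The coefficient p
    -- equals -K S, so it removes S, and q equals -35 E₄ K²/144; what remains is K² times the
    -- equation in τ.
    have hp : (7 * z - 4) / (6 * z * (z - 1)) =
        -branchDeriv (g z) * (2 * E₆ (g z) / (3 * E₄ (g z)) + E₄ (g z) ^ 2 / (2 * E₆ (g z))) := by
      rw [hJ1, branchDeriv]
      generalize g z = τ at *
      subst hz'
      field_simp
      ring
    have hq : -(35 / (144 * z * (z - 1))) = -(35 / 144 * E₄ (g z) * branchDeriv (g z) ^ 2) := by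
      rw [hJ1, branchDeriv]
      generalize g z = τ at *
      subst hz'
      field_simp
    simp only [hp, hq]
    rw [hd2, hd1]
    have h2pi : 2 * π * Complex.I * (2 * π * Complex.I)⁻¹ = 1 := mul_inv_cancel₀ two_pi_I_ne_zero
    linear_combination branchDeriv (g z) ^ 2 * hode (g z) +
      F₁ (g z) * branchDeriv (g z) ^ 2 * (-(E2 (g z) / 6) + 2 * E₆ (g z) / (3 * E₄ (g z)) +
        E₄ (g z) ^ 2 / (2 * E₆ (g z))) * h2pi

/-- `D a₂`. -/
noncomputable def derivA₂ (τ : ℍ) : ℂ := 5 / 12 * (deltaPow (-5) τ * (E₄ τ ^ 2 - E2 τ * E₆ τ))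

/-- `D a₁`. -/
noncomputable def derivA₁ (τ : ℍ) : ℂ :=
  (τ : ℂ) * derivA₂ τ - 5 * (2 * π * Complex.I)⁻¹ * (E₆ τ * deltaPow (-5) τ)

/-- The exponent -5/12 is what cancels the E₂²E₄ terms: -5/12 + 1/12 + 1/3 = 0. -/
theorem hasNormalizedDeriv_a₂ : HasNormalizedDeriv a₂ derivA₂ :=
  ((hasNormalizedDeriv_deltaPow (-5)).mul
    ((hasNormalizedDeriv_E2.mul hasNormalizedDeriv_E₄).sub hasNormalizedDeriv_E₆)).congr fun τ => by
    rw [derivA₂]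
    push_cast
    ring

theorem hasNormalizedDeriv_derivA₂ :
    HasNormalizedDeriv derivA₂ fun τ => E2 τ / 6 * derivA₂ τ + 35 / 144 * E₄ τ * a₂ τ := by
  have h4 := hasNormalizedDeriv_E₄
  have h := ((hasNormalizedDeriv_deltaPow (-5)).mul
    ((h4.mul h4).sub (hasNormalizedDeriv_E2.mul hasNormalizedDeriv_E₆))).const_mul (5 / 12)
  simp only [← pow_two] at h
  refine h.congr fun τ => ?_
  rw [derivA₂, a₂]
  push_cast
  ring

/-- Since -6i/π = 12/(2πi), the correction term carries the same factor (2πi)⁻¹ as Dτ. -/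
theorem a₁_eq (τ : ℍ) :
    a₁ τ = τ * a₂ τ + 12 * (2 * π * Complex.I)⁻¹ * (E₄ τ * deltaPow (-5) τ) := by
  have hpi : (π : ℂ) ≠ 0 := ofReal_ne_zero.2 Real.pi_ne_zero
  rw [a₁]
  field_simp
  linear_combination -12 * E₄ τ * deltaPow (-5) τ * Complex.I_sq

/-- The factor 12 makes the E₂E₄ term of the correction cancel the one in (Dτ) a₂, leaving only E₆.
-/
theorem hasNormalizedDeriv_a₁ : HasNormalizedDeriv a₁ derivA₁ := by
  rw [show a₁ = _ from funext a₁_eq]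
  refine ((hasNormalizedDeriv_coe.mul hasNormalizedDeriv_a₂).add
    ((hasNormalizedDeriv_E₄.mul (hasNormalizedDeriv_deltaPow (-5))).const_mul _)).congr
    fun τ => ?_
  rw [derivA₁, a₂]
  push_cast
  ring

theorem hasNormalizedDeriv_derivA₁ :
    HasNormalizedDeriv derivA₁ fun τ => E2 τ / 6 * derivA₁ τ + 35 / 144 * E₄ τ * a₁ τ := by
  refine ((hasNormalizedDeriv_coe.mul hasNormalizedDeriv_derivA₂).sub
    ((hasNormalizedDeriv_E₆.mul (hasNormalizedDeriv_deltaPow (-5))).const_mul _)).congr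
    fun τ => ?_
  rw [a₁_eq, derivA₁, derivA₂, a₂]
  push_cast
  ring

/-- The terms in τ and in E₂ cancel, leaving a non-zero multiple of Δ^(-5/6) Δ = Δ^(1/6). -/
theorem wronskian_ne_zero (τ : ℍ) : a₁ τ * derivA₂ τ - a₂ τ * derivA₁ τ ≠ 0 := by
  have h : a₁ τ * derivA₂ τ - a₂ τ * derivA₁ τ =
      5 * (2 * π * Complex.I)⁻¹ * deltaPow (-5) τ ^ 2 * (E₄ τ ^ 3 - E₆ τ ^ 2) := by
    rw [a₁_eq, derivA₁, derivA₂, a₂]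
    ring
  have hδ : deltaPow (-5) τ ≠ 0 := zpow_ne_zero _ (eta_ne_zero τ.2)
  rw [h]
  exact mul_ne_zero (mul_ne_zero (mul_ne_zero (by norm_num) (inv_ne_zero two_pi_I_ne_zero))
    (pow_ne_zero 2 hδ)) (E₄_cube_sub_E₆_sq_ne_zero τ)

/-- Two solutions on a domain with nowhere vanishing Wronskian form a fundamental system. -/
theorem isFundamentalSystem_of_wronskian {p q : ℂ → ℂ} {U : Set ℂ} {w₁ w₂ : ℂ → ℂ} (hU : IsOpen U)
    (hc : IsConnected U) (h₁ : IsSolution p q U w₁) (h₂ : IsSolution p q U w₂)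
    (hW : ∀ z ∈ U, w₁ z * deriv w₂ z - w₂ z * deriv w₁ z ≠ 0) :
    IsFundamentalSystem p q U w₁ w₂ := by
  obtain ⟨z₀, hz₀⟩ := hc.nonempty
  have hd {w : ℂ → ℂ} (hw : IsSolution p q U w) {z : ℂ} (hz : z ∈ U) :
      HasDerivAt w (deriv w z) z :=
    (hw.holomorphic.differentiableAt (hU.mem_nhds hz)).hasDerivAt
  have hdd {w : ℂ → ℂ} (hw : IsSolution p q U w) {z : ℂ} (hz : z ∈ U) :
      HasDerivAt (deriv w) (-p z * deriv w z - q z * w z) z := by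
    refine ((hw.holomorphic.deriv hU).differentiableAt (hU.mem_nhds hz)).hasDerivAt.congr_deriv ?_
    linear_combination hw.ode z hz
  have hWd {u v : ℂ → ℂ} (hu : IsSolution p q U u) (hv : IsSolution p q U v) {z : ℂ} (hz : z ∈ U) :
      HasDerivAt (fun z => u z * deriv v z - v z * deriv u z)
        (-p z * (u z * deriv v z - v z * deriv u z)) z := by
    refine (((hd hu hz).mul (hdd hv hz)).sub ((hd hv hz).mul (hdd hu hz))).congr_deriv ?_
    ring
  -- All Wronskians satisfy the same first-order equation W' = -pW, so their quotients are constant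
  -- on the connected set U.
  have hconst {u v : ℂ → ℂ} (hu : IsSolution p q U u) (hv : IsSolution p q U v) :
      ∃ c, ∀ z ∈ U, (u z * deriv v z - v z * deriv u z) /
        (w₁ z * deriv w₂ z - w₂ z * deriv w₁ z) = c := by
    have hq {z : ℂ} (hz : z ∈ U) := (hWd hu hv hz).div (hWd h₁ h₂ hz) (hW z hz)
    refine hU.exists_is_const_of_deriv_eq_zero hc.isPreconnected
      (fun z hz => (hq hz).differentiableAt.differentiableWithinAt) fun z hz => ?_
    refine (hq hz).deriv.trans ?_
    rw [Pi.zero_apply, div_eq_zero_iff]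
    exact Or.inl (by ring)
  refine ⟨h₁, h₂, fun c₁ c₂ h => ?_, fun w hw => ?_⟩
  · have h0 := h z₀ hz₀
    have h1 : c₁ * deriv w₁ z₀ + c₂ * deriv w₂ z₀ = 0 := by
      refine (((hd h₁ hz₀).const_mul c₁).add ((hd h₂ hz₀).const_mul c₂)).unique ?_
      refine (hasDerivAt_const z₀ (0 : ℂ)).congr_of_eventuallyEq ?_
      filter_upwards [hU.mem_nhds hz₀] with z hz using h z hz
    have hW₀ := hW z₀ hz₀
    constructor
    · refine (mul_eq_zero.1 ?_).resolve_right hW₀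
      linear_combination deriv w₂ z₀ * h0 - w₂ z₀ * h1
    · refine (mul_eq_zero.1 ?_).resolve_right hW₀
      linear_combination w₁ z₀ * h1 - deriv w₁ z₀ * h0
  -- Cramer's rule: the coefficients are the Wronskian quotients W(w, w₂)/W(w₁, w₂) and W(w₁,
  -- w)/W(w₁, w₂).
  · obtain ⟨c₁, hc₁⟩ := hconst hw h₂
    obtain ⟨c₂, hc₂⟩ := hconst h₁ hw
    refine ⟨c₁, c₂, fun z hz => ?_⟩
    rw [← hc₁ z hz, ← hc₂ z hz, div_mul_eq_mul_div, div_mul_eq_mul_div, ← add_div,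
      eq_div_iff (hW z hz)]
    ring

theorem isFundamentalSystem_comp_inverseBranch {U : Set ℂ} {g : ℂ → ℍ} (hU : IsOpen U)
    (hc : IsConnected U) (hg : IsInverseBranch U g) :
    IsFundamentalSystem (fun z => (7 * z - 4) / (6 * z * (z - 1)))
      (fun z => -(35 / (144 * z * (z - 1)))) U (fun z => a₁ (g z)) (fun z => a₂ (g z)) := by
  refine isFundamentalSystem_of_wronskian hU hc
    (isSolution_comp_inverseBranch hasNormalizedDeriv_a₁ hasNormalizedDeriv_derivA₁
      (fun τ => by ring) hU hg)
    (isSolution_comp_inverseBranch hasNormalizedDeriv_a₂ hasNormalizedDeriv_derivA₂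
      (fun τ => by ring) hU hg) fun z hz => ?_
  rw [(hasNormalizedDeriv_a₁.comp_inverseBranch hU hg hz).deriv,
    (hasNormalizedDeriv_a₂.comp_inverseBranch hU hg hz).deriv]
  obtain ⟨h4, h6, -⟩ := hg.hasDerivAt_aux hU hz
  have hK : branchDeriv (g z) ≠ 0 := neg_ne_zero.2
    (div_ne_zero (E₄_cube_sub_E₆_sq_ne_zero _) (mul_ne_zero (pow_ne_zero 2 h4) h6))
  convert! mul_ne_zero (wronskian_ne_zero (g z)) hK using 1
  ring

end Equation

/-! ### Local inverses and surjectivity of J -/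

section Branches

open Filter Topology
open scoped Manifold MatrixGroups Real

theorem differentiableOn_J : DifferentiableOn ℂ (J ∘ ofComplex) {z : ℂ | 0 < z.im} :=
  fun z hz => (hasNormalizedDeriv_J ⟨z, hz⟩).differentiableAt.differentiableWithinAt

theorem exists_inverseBranch (τ₀ : ℍ) (h0 : J τ₀ ≠ 0) (h1 : J τ₀ ≠ 1) :
    ∃ (U : Set ℂ) (g : ℂ → ℍ), IsOpen U ∧ IsConnected U ∧ J τ₀ ∈ U ∧ IsInverseBranch U g ∧
      g (J τ₀) = τ₀ := by
  have hne : 2 * π * Complex.I * -(E₄ τ₀ ^ 2 * E₆ τ₀ / (E₄ τ₀ ^ 3 - E₆ τ₀ ^ 2)) ≠ 0 :=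
    mul_ne_zero two_pi_I_ne_zero (neg_ne_zero.2 (div_ne_zero
      (mul_ne_zero (pow_ne_zero 2 (E₄_ne_zero_of_J h0)) (E₆_ne_zero_of_J h1))
      (E₄_cube_sub_E₆_sq_ne_zero τ₀)))
  have hopen : IsOpen {z : ℂ | 0 < z.im} := isOpen_upperHalfPlaneSet
  have hcd : ContDiffAt ℂ 1 (J ∘ ofComplex) τ₀ :=
    (differentiableOn_J.analyticOnNhd hopen τ₀ τ₀.2).contDiffAt
  have hJ0 : (J ∘ ofComplex) τ₀ = J τ₀ := by simp
  have hf : HasFDerivAt (J ∘ ofComplex)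
      (ContinuousLinearEquiv.unitsEquivAut ℂ (Units.mk0 _ hne) : ℂ →L[ℂ] ℂ) τ₀ :=
    (hasNormalizedDeriv_J τ₀).hasFDerivAt_equiv hne
  have hs := hcd.hasStrictFDerivAt' hf one_ne_zero
  set G := hcd.localInverse hf one_ne_zero with hG
  have hG0 : G (J τ₀) = τ₀ := hJ0 ▸ hcd.localInverse_apply_image hf one_ne_zero
  have hGd : ContDiffAt ℂ 1 G (J τ₀) := hJ0 ▸ hcd.to_localInverse hf one_ne_zero
  have hr : ∀ᶠ z in 𝓝 (J τ₀), (J ∘ ofComplex) (G z) = z := hJ0 ▸ hs.eventually_right_inverse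
  have him : ∀ᶠ z in 𝓝 (J τ₀), 0 < (G z).im :=
    hGd.continuousAt (by rw [hG0]; exact hopen.mem_nhds τ₀.2)
  have hdiff : ∀ᶠ z in 𝓝 (J τ₀), DifferentiableAt ℂ G z :=
    (hGd.eventually (by simp)).mono fun z hz => hz.differentiableAt one_ne_zero
  obtain ⟨ε, hε, hball⟩ := Metric.eventually_nhds_iff_ball.1 (hr.and (him.and hdiff))
  refine ⟨Metric.ball (J τ₀) ε, fun z => ofComplex (G z), Metric.isOpen_ball,
    (convex_ball _ _).isConnected ⟨_, Metric.mem_ball_self hε⟩, Metric.mem_ball_self hε,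
    ⟨?_, fun z hz => (hball z hz).1⟩, by simp only [hG0, ofComplex_apply]⟩
  have hGon : DifferentiableOn ℂ G (Metric.ball (J τ₀) ε) :=
    fun z hz => (hball z hz).2.2.differentiableWithinAt
  refine hGon.congr fun z hz => ?_
  rw [ofComplex_apply_of_im_pos (hball z hz).2.1]

/-- If `z` were not a value of `J`, then `1 / (J - z)` would be a modular form of weight zero
vanishing at `i∞`. -/
theorem J_surjective : Function.Surjective J := by
  intro z
  by_contra! hJ
  set f : ℍ → ℂ := fun τ => (J τ - z)⁻¹ with hf
  have hmd : MDiff f := UpperHalfPlane.mdifferentiable_iff.2 <|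
    (differentiableOn_J.sub_const z).inv fun w _ => sub_ne_zero.2 (hJ _)
  have hlim : Tendsto f atImInfty (𝓝 0) := by
    have hN : Tendsto (fun τ : ℍ => E₄ τ ^ 3 - E₆ τ ^ 2) atImInfty (𝓝 0) := by
      simpa using (tendsto_E₄.pow 3).sub (tendsto_E₆.pow 2)
    -- With N = E₄³ - E₆², 1/(J - z) = N/(E₄³ - zN), which tends to 0/1.
    have h1 := hN.div ((tendsto_E₄.pow 3).sub (hN.const_mul z)) (by simp)
    simp only [mul_zero, zero_div] at h1
    refine h1.congr fun τ => ?_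
    have hN := E₄_cube_sub_E₆_sq_ne_zero τ
    have hJτ := sub_ne_zero.2 (hJ τ)
    rw [Pi.div_apply, hf]
    simp only [J] at hJτ ⊢
    have hd : E₄ τ ^ 3 - z * (E₄ τ ^ 3 - E₆ τ ^ 2) ≠ 0 := by
      intro h0
      apply hJτ
      field_simp
      linear_combination h0
    rw [← one_div, div_eq_div_iff hd hJτ]
    field_simp
  have hslash (γ : SL(2, ℤ)) : f ∣[(0 : ℤ)] γ = f := by
    have hJγ (τ : ℍ) : J (γ • τ) = J τ := by
      have h4 := congrFun (slash_eq_self E₄ γ) τ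
      have h6 := congrFun (slash_eq_self E₆ γ) τ
      have hd : denom γ τ ≠ 0 := denom_ne_zero _ _
      rw [SL_slash_apply] at h4 h6
      have hN := E₄_cube_sub_E₆_sq_ne_zero τ
      have hN' := E₄_cube_sub_E₆_sq_ne_zero (γ • τ)
      rw [J, J, div_eq_div_iff hN' hN, ← h4, ← h6]
      simp only [zpow_neg, zpow_ofNat]
      ring
    ext τ
    rw [SL_slash_apply, hf]
    change (J (γ • τ) - z)⁻¹ * (denom γ τ) ^ (-(0 : ℤ)) = _
    simp only [hJγ, neg_zero, zpow_zero, mul_one]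
  obtain ⟨c, hc⟩ := ModularFormClass.levelOne_weight_zero_const
    (modularFormOfInvariant f hmd hslash (isBoundedAtImInfty_of_tendsto hlim))
  have hfc (τ : ℍ) : f τ = c := congrFun hc τ
  have hc0 : c = 0 := tendsto_nhds_unique (tendsto_const_nhds.congr fun τ => (hfc τ).symm) hlim
  -- The constant is 0, yet a reciprocal of a non-zero number is non-zero; any point of ℍ gives the
  -- contradiction.
  exact inv_ne_zero (sub_ne_zero.2 (hJ UpperHalfPlane.I)) ((hfc _).trans hc0)

end Branches

end EisensteinODE

theorem proposition9p1 :
    (∀ z₀ : ℂ, z₀ ≠ 0 → z₀ ≠ 1 → ∃ τ₀ : ℍ, EisensteinODE.J τ₀ = z₀) ∧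
    (∀ τ₀ : ℍ, EisensteinODE.J τ₀ ≠ 0 → EisensteinODE.J τ₀ ≠ 1 →
      ∃ (U : Set ℂ) (g : ℂ → ℍ), IsOpen U ∧ IsConnected U ∧ EisensteinODE.J τ₀ ∈ U ∧
        EisensteinODE.IsInverseBranch U g ∧ g (EisensteinODE.J τ₀) = τ₀) ∧
    (∀ (U : Set ℂ) (g : ℂ → ℍ), IsOpen U → IsConnected U → EisensteinODE.IsInverseBranch U g →
      (∀ z ∈ U, z ≠ 0 ∧ z ≠ 1) ∧
      EisensteinODE.IsFundamentalSystem
        (fun z => (7 * z - 4) / (6 * z * (z - 1)))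
        (fun z => -(35 / (144 * z * (z - 1))))
        U
        (fun z => EisensteinODE.a₁ (g z))
        (fun z => EisensteinODE.a₂ (g z))) :=
  ⟨fun z₀ _ _ => EisensteinODE.J_surjective z₀, EisensteinODE.exists_inverseBranch,
    fun _ _ hU hc hg => ⟨fun _ hz => hg.ne_zero_ne_one hU hz,
      EisensteinODE.isFundamentalSystem_comp_inverseBranch hU hc hg⟩⟩
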